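/- Let $\nu$ be a measure on $(0,\infty)$ with $\int_{(0,\infty)}\min\{1,x\}\,\nu(dx)<\infty$ and $\nu((0,\infty))=\infty$, and put $f(u)=\int_{(0,\infty)}(1-e^{-ux})\,\nu(dx)$ for $u\ge 0$. On a probability space $(\Omega,\mathcal F,\mathbb P)$ let $T^f=(T^f(t))_{t\ge 0}$ be a subordinator with Laplace exponent $f$, i.e. a process with $T^f(0)=0$ a.s., with stationary and independent increments and a.s. increasing, right-continuous paths with finite left limits, such that $\mathbb E\, e^{-uT^f(t)}=e^{-tf(u)}$ for all $t,u\ge 0$. Let $S^f(t)=\inf\{\tau>0 : T^f(\tau)>t\}$, $t\ge 0$, be the inverse subordinator, let $B$ be a standard one-dimensional Brownian motion such that $B$ and $S^f$ are independent, and let $X(t)=B(S^f(t))$, $t\ge 0$. Then \[ \lim_{t\to\infty}\frac{X(t)}{t}=0\qquad\text{almost surely.} \] -/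

import Mathlib

open MeasureTheory ProbabilityTheory Filter Topology
open scoped NNReal ENNReal

noncomputable section

namespace DelayedBM

variable {Ω : Type*} {mΩ : MeasurableSpace Ω}

/-- A path `x : [0,∞) → ℝ` that is right-continuous and has finite left limits. (At `t = 0` the
left-limit condition is void.) -/
structure IsCadlagPath (x : ℝ≥0 → ℝ) : Prop where
  right_cont : ∀ t, ContinuousWithinAt x (Set.Ici t) t
  left_lim : ∀ t, ∃ l : ℝ, Tendsto x (𝓝[<] t) (𝓝 l)

/-- A real-valued Lévy process: it starts at `0`, has independent and stationary increments, and
almost all of its paths are right-continuous with finite left limits. -/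
structure IsLevyProcess (T : ℝ≥0 → Ω → ℝ) (P : Measure Ω) : Prop where
  aemeasurable : ∀ t, AEMeasurable (T t) P
  zero : ∀ᵐ ω ∂P, T 0 ω = 0
  indep_increments : HasIndepIncrements T P
  stationary_increments : ∀ s t, IdentDistrib (fun ω ↦ T (s + t) ω - T s ω) (T t) P P
  cadlag : ∀ᵐ ω ∂P, IsCadlagPath (fun t ↦ T t ω)

/-- A subordinator: a Lévy process with almost surely increasing (non-decreasing) paths. -/
structure IsSubordinator (T : ℝ≥0 → Ω → ℝ) (P : Measure Ω) : Prop
    extends IsLevyProcess T P where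
  mono : ∀ᵐ ω ∂P, Monotone (fun t ↦ T t ω)

/-- A Lévy measure of a subordinator: a measure supported in `(0,∞)` with
`∫_{(0,∞)} min {1, x} ν(dx) < ∞`. -/
structure IsSubordinatorLevyMeasure (ν : Measure ℝ) : Prop where
  support : ν (Set.Iic 0) = 0
  lintegral_lt_top : ∫⁻ x in Set.Ioi (0 : ℝ), ENNReal.ofReal (min 1 x) ∂ν < ∞

/-- The Bernstein function `f(u) = ∫_{(0,∞)} (1 - e^{-ux}) ν(dx)` without drift and with Lévy
measure `ν`. For `u ≥ 0` the integrand is `ν`-integrable whenever `ν` is a Lévy measure. -/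
def bernstein (ν : Measure ℝ) (u : ℝ) : ℝ :=
  ∫ x in Set.Ioi (0 : ℝ), (1 - Real.exp (-(u * x))) ∂ν

/-- `f` is the Laplace exponent of `T`: `E e^{-u T(t)} = e^{-t f(u)}` for all `t, u ≥ 0`. -/
def HasLaplaceExponent (T : ℝ≥0 → Ω → ℝ) (f : ℝ → ℝ) (P : Measure Ω) : Prop :=
  ∀ (t : ℝ≥0) (u : ℝ), 0 ≤ u → ∫ ω, Real.exp (-(u * T t ω)) ∂P = Real.exp (-(t * f u))

/-- The inverse subordinator (first-passage time process)
`S(t) = inf {τ > 0 : T(τ) > t}`. For a subordinator with a non-zero Lévy measure almost all paths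
are unbounded, so that almost surely the infimum is over a non-empty set for every `t`. -/
def inverseSubordinator (T : ℝ≥0 → Ω → ℝ) (t : ℝ≥0) (ω : Ω) : ℝ≥0 :=
  sInf {τ : ℝ≥0 | 0 < τ ∧ (t : ℝ) < T τ ω}

/-- The subdiffusion process `X(t) = B(S(t))`, where `S` is the inverse of `T`. -/
def subdiffusion (B T : ℝ≥0 → Ω → ℝ) (t : ℝ≥0) (ω : Ω) : ℝ :=
  B (inverseSubordinator T t ω) ω

end DelayedBM

end

/-!
The claim reduces to linear bounds along almost every path. The Chernoff bound and the
Borel–Cantelli lemma turn `f u > 0` into linear growth of `T` along the integers, so `S(t) = O(t)`.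
Time inversion gives `B(s) = o(s)`: the process `t B(1/t)` has the finite-dimensional laws of `B`,
these laws determine whether it converges to `0` at `0` along a countable dense set of times, and
continuity on `(0,∞)` extends the convergence to all times. Since the paths of `B` are locally
bounded, `B(s) = o(s)` yields `|B(s)| ≤ ε s + C` for all `s`, whence `B(S(t)) = o(t)` whether or not
`S(t)` tends to `∞`.
-/

open Asymptotics

namespace DelayedBM

theorem tendsto_nhdsWithin_of_denseRange {T E ι : Type*} [TopologicalSpace T] [TopologicalSpace E]
    [RegularSpace E] {x : T → E} {d : ι → T} {s : Set T} {a : T} {c : E} (hd : DenseRange d)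
    (hs : IsOpen s) (hx : ContinuousOn x s) (h : Tendsto (x ∘ d) (comap d (𝓝[s] a)) (𝓝 c)) :
    Tendsto x (𝓝[s] a) (𝓝 c) := by
  rw [(closed_nhds_basis c).tendsto_right_iff]
  rintro V ⟨hVc, hV⟩
  obtain ⟨U, hU, hUV⟩ := mem_comap.1 (h hVc)
  obtain ⟨W, hW, haW, hWU⟩ := mem_nhdsWithin.1 hU
  filter_upwards [inter_mem_nhdsWithin s (hW.mem_nhds haW)] with t ⟨hts, htW⟩
  have h_open : IsOpen (W ∩ s) := hW.inter hs
  have ht_closure : t ∈ closure (W ∩ s ∩ Set.range d) :=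
    hd.open_subset_closure_inter h_open ⟨htW, hts⟩
  refine hV.closure_eq ▸ ((hx t hts).mono fun r hr ↦ hr.1.2).mem_closure ht_closure ?_
  rintro _ ⟨hr, i, rfl⟩
  exact hUV (hWU hr)

section FiniteDimensionalDistributions

variable {T Ω E ι : Type*} {mΩ : MeasurableSpace Ω} {P : Measure Ω} [IsFiniteMeasure P]
  [MeasurableSpace E] {X Y : T → Ω → E}

theorem identDistrib_comp_of_forall_finset_identDistrib [Countable ι]
    (hXY : ∀ I : Finset T, IdentDistrib (fun ω ↦ I.restrict (X · ω))
      (fun ω ↦ I.restrict (Y · ω)) P P) (d : ι → T) :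
    IdentDistrib (fun ω i ↦ X (d i) ω) (fun ω i ↦ Y (d i) ω) P P := by
  classical
  have h_restrict (J : Finset ι) : IdentDistrib (fun ω ↦ J.restrict fun i ↦ X (d i) ω)
      (fun ω ↦ J.restrict fun i ↦ Y (d i) ω) P P := by
    have h_reindex : Measurable fun (x : J.image d → E) (i : J) ↦
        x ⟨d i, Finset.mem_image_of_mem d i.2⟩ := by
      fun_prop
    exact (hXY (J.image d)).comp h_reindex
  have h_eval (t : T) : IdentDistrib (X t) (Y t) P P :=
    (hXY {t}).comp
      (measurable_pi_apply (⟨t, Finset.mem_singleton_self t⟩ : ({t} : Finset T)))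
  exact (identDistrib_iff_forall_finset_identDistrib
    (aemeasurable_pi_lambda _ fun i ↦ (h_eval (d i)).aemeasurable_fst)
    (aemeasurable_pi_lambda _ fun i ↦ (h_eval (d i)).aemeasurable_snd)).2 h_restrict

variable [TopologicalSpace T] [TopologicalSpace.SeparableSpace T]
  [TopologicalSpace E] [TopologicalSpace.PseudoMetrizableSpace E] [OpensMeasurableSpace E]

theorem ae_tendsto_nhdsWithin_of_forall_finset_identDistrib {s : Set T} {a : T}
    [(𝓝[s] a).IsCountablyGenerated] {c : E} (hs : IsOpen s)
    (hXY : ∀ I : Finset T, IdentDistrib (fun ω ↦ I.restrict (X · ω))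
      (fun ω ↦ I.restrict (Y · ω)) P P)
    (hX : ∀ᵐ ω ∂P, Tendsto (X · ω) (𝓝[s] a) (𝓝 c))
    (hY : ∀ᵐ ω ∂P, ContinuousOn (Y · ω) s) :
    ∀ᵐ ω ∂P, Tendsto (Y · ω) (𝓝[s] a) (𝓝 c) := by
  obtain ⟨D, hD_countable, hD⟩ := TopologicalSpace.exists_countable_dense T
  have := hD_countable.to_subtype
  have h_meas : MeasurableSet
      {x : D → E | Tendsto x (comap Subtype.val (𝓝[s] a)) (𝓝 c)} :=
    measurableSet_tendsto (𝓝 c) measurable_pi_apply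
  have hY_dense := (identDistrib_comp_of_forall_finset_identDistrib hXY ((↑) : D → T)).ae_mem_snd
    h_meas (hX.mono fun ω hω ↦ hω.comp tendsto_comap)
  filter_upwards [hY, hY_dense] with ω hω hω_dense
  exact tendsto_nhdsWithin_of_denseRange hD.denseRange_val hs hω hω_dense

end FiniteDimensionalDistributions

section SublinearGrowth

theorem exists_forall_norm_le_mul_add_of_isLittleO {E : Type*} [SeminormedAddCommGroup E]
    {b : ℝ≥0 → E} (hb : Continuous b) (hbo : b =o[atTop] ((↑) : ℝ≥0 → ℝ)) {ε : ℝ} (hε : 0 < ε) :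
    ∃ C : ℝ, ∀ s : ℝ≥0, ‖b s‖ ≤ ε * s + C := by
  obtain ⟨M, hM⟩ := eventually_atTop.1 (hbo.bound hε)
  obtain ⟨C, hC⟩ := (isCompact_Icc (a := 0) (b := M)).exists_bound_of_continuousOn hb.continuousOn
  have hC_nonneg : 0 ≤ C := (norm_nonneg _).trans (hC 0 ⟨le_rfl, zero_le⟩)
  refine ⟨C, fun s ↦ ?_⟩
  rcases le_total s M with hsM | hMs
  · exact (hC s ⟨zero_le, hsM⟩).trans (le_add_of_nonneg_left (by positivity))
  · have := hM s hMs
    rw [NNReal.norm_eq] at this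
    linarith

theorem isLittleO_comp_of_continuous {E F α : Type*} [SeminormedAddCommGroup E]
    [SeminormedAddCommGroup F] {b : ℝ≥0 → E} {S : α → ℝ≥0} {g : α → F} {l : Filter α}
    (hb : Continuous b) (hbo : b =o[atTop] ((↑) : ℝ≥0 → ℝ)) (hS : (fun t ↦ (S t : ℝ)) =O[l] g)
    (hg : Tendsto (fun t ↦ ‖g t‖) l atTop) : (fun t ↦ b (S t)) =o[l] g := by
  obtain ⟨K, hK_pos, hK⟩ := hS.exists_pos
  refine isLittleO_iff.2 fun ε hε ↦ ?_
  obtain ⟨C, hC⟩ := exists_forall_norm_le_mul_add_of_isLittleO hb hbo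
    (show 0 < ε / (2 * K) by positivity)
  filter_upwards [hK.bound, hg.eventually_ge_atTop (2 * C / ε)] with t hSt hCt
  rw [NNReal.norm_eq] at hSt
  rw [div_le_iff₀ hε] at hCt
  calc ‖b (S t)‖ ≤ ε / (2 * K) * S t + C := hC _
    _ ≤ ε / (2 * K) * (K * ‖g t‖) + C := by gcongr
    _ = ε / 2 * ‖g t‖ + C := by field_simp
    _ ≤ ε * ‖g t‖ := by linarith

end SublinearGrowth

section LaplaceExponent

variable {ν : Measure ℝ} {u : ℝ}

theorem integrableOn_one_sub_exp (hν : IsSubordinatorLevyMeasure ν) (hu : 0 ≤ u) :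
    IntegrableOn (fun x ↦ 1 - Real.exp (-(u * x))) (Set.Ioi 0) ν := by
  have h_min : IntegrableOn (fun x : ℝ ↦ min 1 x) (Set.Ioi 0) ν := by
    refine ⟨by fun_prop, ?_⟩
    rw [hasFiniteIntegral_iff_ofReal]
    · exact hν.lintegral_lt_top
    · filter_upwards [ae_restrict_mem measurableSet_Ioi] with x hx
      exact le_min zero_le_one (le_of_lt hx)
  refine (h_min.const_mul (max 1 u)).mono' (by fun_prop) ?_
  filter_upwards [ae_restrict_mem measurableSet_Ioi] with x (hx : 0 < x)
  have hux : 0 ≤ u * x := by positivity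
  rw [Real.norm_of_nonneg (by simpa using hux), mul_min_of_nonneg _ _ (by positivity), mul_one]
  refine le_min ?_ ?_
  · linarith [Real.exp_pos (-(u * x)), le_max_left 1 u]
  · calc 1 - Real.exp (-(u * x)) ≤ u * x := by linarith [Real.one_sub_le_exp_neg (u * x)]
      _ ≤ max 1 u * x := by gcongr; exact le_max_right 1 u

theorem bernstein_pos (hν : IsSubordinatorLevyMeasure ν) (hν_ne : ν (Set.Ioi 0) ≠ 0)
    (hu : 0 < u) : 0 < bernstein ν u := by
  have h_pos {x : ℝ} (hx : 0 < x) : 0 < 1 - Real.exp (-(u * x)) := by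
    simpa using mul_pos hu hx
  have h_support : Set.Ioi 0 ⊆ Function.support fun x ↦ 1 - Real.exp (-(u * x)) :=
    fun x hx ↦ (h_pos hx).ne'
  rw [bernstein, setIntegral_pos_iff_support_of_nonneg_ae _ (integrableOn_one_sub_exp hν hu.le),
    Set.inter_eq_right.2 h_support]
  · exact pos_iff_ne_zero.2 hν_ne
  · filter_upwards [ae_restrict_mem measurableSet_Ioi] with x hx
    exact (h_pos hx).le

variable {Ω : Type*} {mΩ : MeasurableSpace Ω} {P : Measure Ω} [IsFiniteMeasure P]
  {T : ℝ≥0 → Ω → ℝ} {f : ℝ → ℝ} {c : ℝ}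

theorem measureReal_le_mul_le_exp_of_hasLaplaceExponent (hT : HasLaplaceExponent T f P)
    (hu : 0 ≤ u) (t : ℝ≥0) :
    P.real {ω | T t ω ≤ c * t} ≤ Real.exp (t * -(f u - u * c)) := by
  have h_mgf : mgf (T t) P (-u) = Real.exp (-(t * f u)) := by
    simpa only [mgf, neg_mul] using hT t u hu
  have h_int : Integrable (fun ω ↦ Real.exp (-u * T t ω)) P :=
    .of_integral_ne_zero (h_mgf.trans_ne (Real.exp_ne_zero _))
  calc P.real {ω | T t ω ≤ c * t}
      ≤ Real.exp (-(-u) * (c * t)) * mgf (T t) P (-u) :=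
        measure_le_le_exp_mul_mgf _ (neg_nonpos.2 hu) h_int
    _ = Real.exp (t * -(f u - u * c)) := by
        rw [h_mgf, ← Real.exp_add]
        ring_nf

theorem ae_eventually_mul_lt_of_hasLaplaceExponent (hT : HasLaplaceExponent T f P) (hu : 0 ≤ u)
    (hc : u * c < f u) : ∀ᵐ ω ∂P, ∀ᶠ n : ℕ in atTop, c * n < T n ω := by
  have h_le (n : ℕ) : P.real {ω | T n ω ≤ c * n} ≤ Real.exp (n * -(f u - u * c)) := by
    exact_mod_cast measureReal_le_mul_le_exp_of_hasLaplaceExponent (c := c) hT hu n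
  have h_summable : Summable fun n : ℕ ↦ P.real {ω | T n ω ≤ c * n} :=
    (Real.summable_exp_nat_mul_iff.2 (by linarith)).of_nonneg_of_le
      (fun _ ↦ measureReal_nonneg) h_le
  have h_tsum : ∑' n : ℕ, P {ω | T n ω ≤ c * n} ≠ ∞ := by
    simpa only [ofReal_measureReal (measure_ne_top P _)] using h_summable.tsum_ofReal_ne_top
  filter_upwards [ae_eventually_notMem h_tsum] with ω hω
  exact hω.mono fun n hn ↦ not_le.1 hn

end LaplaceExponent

section InverseSubordinator

variable {Ω : Type*} {T : ℝ≥0 → Ω → ℝ} {ω : Ω}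

theorem inverseSubordinator_le {t τ : ℝ≥0} (hτ : 0 < τ) (h : (t : ℝ) < T τ ω) :
    inverseSubordinator T t ω ≤ τ :=
  csInf_le (OrderBot.bddBelow _) ⟨hτ, h⟩

theorem isBigO_inverseSubordinator {c : ℝ} (hc : 0 < c)
    (h : ∀ᶠ n : ℕ in atTop, c * n < T n ω) :
    (fun t ↦ (inverseSubordinator T t ω : ℝ)) =O[atTop] ((↑) : ℝ≥0 → ℝ) := by
  have h_div : Tendsto (fun t : ℝ≥0 ↦ (t : ℝ) / c) atTop atTop :=
    (NNReal.tendsto_coe_atTop.2 tendsto_id).atTop_div_const hc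
  refine .of_bound (c⁻¹ + 1) ?_
  filter_upwards [(tendsto_nat_ceil_atTop.comp h_div).eventually h, eventually_ge_atTop 1]
    with t hT ht
  have ht_le : (t : ℝ) ≤ c * ⌈(t : ℝ) / c⌉₊ := (div_le_iff₀' hc).1 (Nat.le_ceil _)
  have h_ceil_pos : (0 : ℝ≥0) < ⌈(t : ℝ) / c⌉₊ :=
    Nat.cast_pos.2 (Nat.ceil_pos.2 (by positivity))
  rw [NNReal.norm_eq, NNReal.norm_eq]
  calc (inverseSubordinator T t ω : ℝ) ≤ ⌈(t : ℝ) / c⌉₊ :=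
        mod_cast inverseSubordinator_le h_ceil_pos (ht_le.trans_lt hT)
    _ ≤ t / c + 1 := (Nat.ceil_lt_add_one (by positivity)).le
    _ ≤ (c⁻¹ + 1) * t := by
        rw [add_mul, one_mul, div_eq_inv_mul]
        gcongr
        exact_mod_cast ht

end InverseSubordinator

theorem ae_isLittleO_of_isBrownianReal {Ω : Type*} {mΩ : MeasurableSpace Ω} {P : Measure Ω}
    {B : ℝ≥0 → Ω → ℝ} (hB : IsBrownianReal B P) :
    ∀ᵐ ω ∂P, (B · ω) =o[atTop] ((↑) : ℝ≥0 → ℝ) := by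
  have := hB.isGaussianProcess.isProbabilityMeasure
  have hW := hB.toIsPreBrownianReal.inv
  have h_zero : ∀ᵐ ω ∂P, Tendsto (fun t : ℝ≥0 ↦ t * B (1 / t) ω) (𝓝[>] 0) (𝓝 0) := by
    refine ae_tendsto_nhdsWithin_of_forall_finset_identDistrib isOpen_Ioi
      (fun I ↦ (hB.hasLaw I).identDistrib (hW.hasLaw I))
      (hB.tendsto_nhds_zero.mono fun ω hω ↦ hω.mono_left nhdsWithin_le_nhds) ?_
    filter_upwards [hB.cont] with ω hω
    refine NNReal.continuous_coe.continuousOn.mul (hω.comp_continuousOn ?_)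
    exact continuousOn_const.div continuousOn_id fun t ht ↦ ht.ne'
  filter_upwards [h_zero] with ω hω
  refine isLittleO_of_tendsto' ?_ ?_
  · filter_upwards [eventually_gt_atTop 0] with s hs h
    exact absurd (NNReal.coe_eq_zero.1 h) hs.ne'
  · refine (hω.comp tendsto_inv_atTop_nhdsGT_zero).congr fun s ↦ ?_
    simp [div_eq_inv_mul]

end DelayedBM

theorem mainTheorem5_general {Ω : Type*} {mΩ : MeasurableSpace Ω} {P : Measure Ω}
    {T B : ℝ≥0 → Ω → ℝ} {f : ℝ → ℝ} {u : ℝ} (hT : DelayedBM.HasLaplaceExponent T f P)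
    (hu : 0 ≤ u) (hf : 0 < f u) (hB : IsBrownianReal B P) :
    ∀ᵐ ω ∂P, Tendsto (fun t : ℝ≥0 ↦ DelayedBM.subdiffusion B T t ω / (t : ℝ)) atTop (𝓝 0) := by
  have := hB.isGaussianProcess.isProbabilityMeasure
  obtain ⟨c, hc_pos, hc⟩ := exists_pos_mul_lt hf u
  filter_upwards [hB.cont, DelayedBM.ae_isLittleO_of_isBrownianReal hB,
    DelayedBM.ae_eventually_mul_lt_of_hasLaplaceExponent hT hu hc] with ω hB_cont hB_o hT_lt
  have hS := DelayedBM.isBigO_inverseSubordinator hc_pos hT_lt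
  have h_atTop : Tendsto (fun t : ℝ≥0 ↦ ‖(t : ℝ)‖) atTop atTop := by
    simpa only [NNReal.norm_eq, id] using NNReal.tendsto_coe_atTop.2 tendsto_id
  exact (DelayedBM.isLittleO_comp_of_continuous hB_cont hB_o hS h_atTop).tendsto_div_nhds_zero

/-- **Law of large numbers** for a Brownian motion delayed by an independent inverse
subordinator. -/
theorem mainTheorem5 {Ω : Type*} [MeasurableSpace Ω] (P : Measure Ω) [IsProbabilityMeasure P]
    (ν : Measure ℝ) (hν : DelayedBM.IsSubordinatorLevyMeasure ν)
    (hν_inf : ν (Set.Ioi 0) = ∞)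
    (T : ℝ≥0 → Ω → ℝ) (hT : DelayedBM.IsSubordinator T P)
    (hTν : DelayedBM.HasLaplaceExponent T (DelayedBM.bernstein ν) P)
    (B : ℝ≥0 → Ω → ℝ) (hB : IsBrownianReal B P)
    (hBS : IndepFun (fun ω (t : ℝ≥0) ↦ B t ω)
      (fun ω (t : ℝ≥0) ↦ DelayedBM.inverseSubordinator T t ω) P) :
    ∀ᵐ ω ∂P, Tendsto (fun t : ℝ≥0 ↦ DelayedBM.subdiffusion B T t ω / (t : ℝ)) atTop (𝓝 0) := by
  exact mainTheorem5_general hTν zero_le_one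
    (DelayedBM.bernstein_pos hν (by simp [hν_inf]) one_pos) hB
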